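/- Equip Baire space $\mathbb{N}^{\mathbb{N}}$ with the product of the discrete topologies. Call a set $Q\subseteq\mathbb{N}^{\mathbb{N}}$ a $\Pi^0_1$ set if there is a computable tree $T\subseteq\mathbb{N}^{<\mathbb{N}}$ (a set of finite sequences of natural numbers closed under initial segments, with decidable membership) such that $Q$ is the set of infinite paths through $T$, that is, $Q=\{f\in\mathbb{N}^{\mathbb{N}} : \langle f(0),\dots,f(n-1)\rangle\in T \text{ for all } n\}$. **Theorem.** There is a nonempty closed (in fact $\Pi^0_1$) set $Q\subseteq\mathbb{N}^{\mathbb{N}}$ that is not compact and such that any two distinct elements of $Q$ are Turing incomparable: if $f,g\in Q$ and $f\neq g$, then $f\nleq_T g$ and $g\nleq_T f$. -/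

import Mathlib

/-- The initial segment `⟨f 0, …, f (n - 1)⟩` of length `n` of a point `f` of Baire space. -/
def initialSegment (f : ℕ → ℕ) (n : ℕ) : List ℕ :=
  (List.range n).map f

/-- The set `[T]` of infinite paths through a tree `T` of finite sequences of natural numbers. -/
def treePaths (T : Descriptive.tree ℕ) : Set (ℕ → ℕ) :=
  {f | ∀ n : ℕ, initialSegment f n ∈ T}

/-- A subset of Baire space is (lightface) `Π⁰₁`, or effectively closed, if it is the set of
infinite paths through a computable tree of finite sequences of natural numbers. -/
def IsPiZeroOne (Q : Set (ℕ → ℕ)) : Prop :=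
  ∃ T : Descriptive.tree ℕ, ComputablePred (fun σ : List ℕ => σ ∈ T) ∧ Q = treePaths T

/-- Two total functions are Turing incomparable if neither is computable from the other. -/
def TuringIncomparable (f g : ℕ → ℕ) : Prop :=
  ¬ TuringReducible (f : ℕ →. ℕ) (g : ℕ →. ℕ) ∧ ¬ TuringReducible (g : ℕ →. ℕ) (f : ℕ →. ℕ)

/-! A finite extension construction, limit computable because each step asks one existential
question, builds an array `A` whose columns are pairwise Turing incomparable. Step `e = (c, i, j)`
looks for an extension on which `c` gives, at a fresh argument `x`, a value different from entry `x`
of column `j`. If there is none, column `i` cannot compute column `j` via `c`: a true computation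
could be contradicted by altering that one entry, which leaves column `i` alone
(`genericArray_column_not_reducible`).

Column `n` is then replaced by `columnPath n`, of the same degree, which records for every `x` and
`s` a stage from `s` on whose guess at entry `x` is correct. A guess repeated at arbitrarily late
stages must be the limit, so a computable local condition defines exactly these paths
(`eq_columnPath`). Each path carries its index `n`, so the set is unbounded at coordinate 0 and
hence not compact. -/

open Filter

/-! ### Finite oracles and the use principle -/

/-- The prefix of length `n` of `A`, read as a finite oracle. -/
def oraclePrefix (A : ℕ → ℕ) (n : ℕ) : List ℕ := (List.range n).map A

theorem oraclePrefix_getElem? {A : ℕ → ℕ} {n m : ℕ} :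
    (oraclePrefix A n)[m]? = if m < n then some (A m) else none := by
  unfold oraclePrefix
  split_ifs with h <;> simp [h]

/-- `φ` is a partial recursive functional on finite oracles that depends monotonically on the
`i`-th column of its oracle and computes `h` in the limit from the `i`-th column of `A`. -/
structure IsFunctionalFor (A : ℕ → ℕ) (i : ℕ) (φ : List ℕ → ℕ →. ℕ) (h : ℕ →. ℕ) : Prop where
  partrec : Partrec₂ φ
  mono : ∀ τ τ' : List ℕ,
    (∀ z v, τ[Nat.pair i z]? = some v → τ'[Nat.pair i z]? = some v) →
      ∀ x y, y ∈ φ τ x → y ∈ φ τ' x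
  sound : ∀ x y n, y ∈ φ (oraclePrefix A n) x → y ∈ h x
  complete : ∀ x y, y ∈ h x → ∀ᶠ n in atTop, y ∈ φ (oraclePrefix A n) x

namespace IsFunctionalFor

variable {A : ℕ → ℕ} {i : ℕ} {φ ψ : List ℕ → ℕ →. ℕ} {f g : ℕ →. ℕ}

theorem of_partrec (hf : Nat.Partrec f) : IsFunctionalFor A i (fun _ => f) f where
  partrec := (Partrec.nat_iff.2 hf).comp Computable.snd
  mono _ _ _ _ _ h := h
  sound _ _ _ h := h
  complete _ _ h := Eventually.of_forall fun _ => h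

theorem oracle : IsFunctionalFor A i (fun τ z => (τ[Nat.pair i z]? : Option ℕ))
    (fun z => Part.some (A (Nat.pair i z))) where
  partrec := Computable.ofOption (Computable.list_getElem?.comp Computable.fst
    ((Primrec₂.natPair.comp (Primrec.const i) Primrec.snd).to_comp))
  mono τ τ' h x y hy := by
    simp only [Part.mem_coe, Option.mem_def] at hy ⊢
    exact h _ _ hy
  sound x y n hy := by
    simp only [Part.mem_coe, Option.mem_def, oraclePrefix_getElem?] at hy
    split_ifs at hy
    simpa using hy.symm
  complete x y hy := by
    filter_upwards [eventually_gt_atTop (Nat.pair i x)] with n hn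
    rw [Part.mem_some_iff] at hy
    simp [oraclePrefix_getElem?, hn, hy]

theorem pair (hf : IsFunctionalFor A i φ f) (hg : IsFunctionalFor A i ψ g) :
    IsFunctionalFor A i (fun τ n => (φ τ n).bind fun a => (ψ τ n).map fun b => Nat.pair a b)
      (fun n => Nat.pair <$> f n <*> g n) where
  partrec := Partrec.bind hf.partrec (Partrec.map (hg.partrec.comp (Computable.fst.comp Computable.fst)
      (Computable.snd.comp Computable.fst))
      (Primrec₂.natPair.comp (Primrec.snd.comp Primrec.fst) Primrec.snd).to_comp)
  mono τ τ' h x y hy := by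
    simp only [Part.mem_bind_iff, Part.mem_map_iff] at hy ⊢
    obtain ⟨a, ha, b, hb, rfl⟩ := hy
    exact ⟨a, hf.mono _ _ h _ _ ha, b, hg.mono _ _ h _ _ hb, rfl⟩
  sound x y n hy := by
    simp only [Part.mem_bind_iff, Part.mem_map_iff] at hy
    obtain ⟨a, ha, b, hb, rfl⟩ := hy
    simp only [Seq.seq, Part.map_eq_map, Part.mem_bind_iff, Part.mem_map_iff]
    exact ⟨_, ⟨a, hf.sound _ _ _ ha, rfl⟩, b, hg.sound _ _ _ hb, rfl⟩
  complete x y hy := by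
    simp only [Seq.seq, Part.map_eq_map, Part.mem_bind_iff, Part.mem_map_iff] at hy
    obtain ⟨_, ⟨a, ha, rfl⟩, b, hb, rfl⟩ := hy
    filter_upwards [hf.complete _ _ ha, hg.complete _ _ hb] with n h1 h2
    simp only [Part.mem_bind_iff, Part.mem_map_iff]
    exact ⟨a, h1, b, h2, rfl⟩

theorem comp (hf : IsFunctionalFor A i φ f) (hg : IsFunctionalFor A i ψ g) :
    IsFunctionalFor A i (fun τ n => (ψ τ n).bind fun a => φ τ a) (fun n => g n >>= f) where
  partrec := Partrec.bind hg.partrec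
    (hf.partrec.comp (Computable.fst.comp Computable.fst) Computable.snd)
  mono τ τ' h x y hy := by
    simp only [Part.mem_bind_iff] at hy ⊢
    obtain ⟨a, ha, hb⟩ := hy
    exact ⟨a, hg.mono _ _ h _ _ ha, hf.mono _ _ h _ _ hb⟩
  sound x y n hy := by
    obtain ⟨a, ha, hb⟩ := Part.mem_bind_iff.1 hy
    exact Part.mem_bind_iff.2 ⟨a, hg.sound _ _ _ ha, hf.sound _ _ _ hb⟩
  complete x y hy := by
    obtain ⟨a, ha, hb⟩ := Part.mem_bind_iff.1 hy
    filter_upwards [hg.complete _ _ ha, hf.complete _ _ hb] with n h1 h2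
    exact Part.mem_bind_iff.2 ⟨a, h1, h2⟩

theorem prec (hf : IsFunctionalFor A i φ f) (hg : IsFunctionalFor A i ψ g) :
    IsFunctionalFor A i
      (fun τ p => Nat.rec (φ τ p.unpair.1)
        (fun y IH => IH.bind fun k => ψ τ (Nat.pair p.unpair.1 (Nat.pair y k))) p.unpair.2)
      (fun p =>
        let (a, n) := Nat.unpair p
        n.rec (f a) fun y IH => do
          let k ← IH
          g (Nat.pair a (Nat.pair y k))) where
  partrec := by
    refine Partrec.nat_rec (f := fun q : List ℕ × ℕ => q.2.unpair.2)
      (g := fun q : List ℕ × ℕ => φ q.1 q.2.unpair.1)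
      (h := fun (q : List ℕ × ℕ) (r : ℕ × ℕ) =>
        ψ q.1 (Nat.pair q.2.unpair.1 (Nat.pair r.1 r.2))) ?_ ?_ ?_
    · exact (Primrec.snd.comp (Primrec.unpair.comp Primrec.snd)).to_comp
    · exact hf.partrec.comp Computable.fst
        (Primrec.fst.comp (Primrec.unpair.comp Primrec.snd)).to_comp
    · refine hg.partrec.comp (Computable.fst.comp Computable.fst) (Primrec.to_comp ?_)
      exact Primrec₂.natPair.comp
        (Primrec.fst.comp (Primrec.unpair.comp (Primrec.snd.comp Primrec.fst)))
        (Primrec₂.natPair.comp (Primrec.fst.comp Primrec.snd) (Primrec.snd.comp Primrec.snd))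
  mono τ τ' h x := by
    generalize x.unpair.1 = a
    induction x.unpair.2 with
    | zero => exact fun y hy => hf.mono _ _ h _ _ hy
    | succ m ih =>
      intro y hy
      simp only [Part.mem_bind_iff] at hy ⊢
      obtain ⟨k, hk, hy⟩ := hy
      exact ⟨k, ih _ hk, hg.mono _ _ h _ _ hy⟩
  sound x y n := by
    dsimp only
    generalize x.unpair.1 = a
    induction x.unpair.2 generalizing y with
    | zero => exact fun hy => hf.sound _ _ _ hy
    | succ m ih =>
      intro hy
      simp only [Part.bind_eq_bind, Part.mem_bind_iff] at hy ih ⊢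
      obtain ⟨k, hk, hy⟩ := hy
      exact ⟨k, ih _ hk, hg.sound _ _ _ hy⟩
  complete x y := by
    dsimp only
    generalize x.unpair.1 = a
    induction x.unpair.2 generalizing y with
    | zero => exact fun hy => hf.complete _ _ hy
    | succ m ih =>
      intro hy
      simp only [Part.bind_eq_bind, Part.mem_bind_iff] at hy ih ⊢
      obtain ⟨k, hk, hy⟩ := hy
      filter_upwards [ih _ hk, hg.complete _ _ hy] with n h1 h2
      exact ⟨k, h1, h2⟩

theorem rfind (hf : IsFunctionalFor A i φ f) :
    IsFunctionalFor A i
      (fun τ a => Nat.rfind fun n => (φ τ (Nat.pair a n)).map fun m => decide (m = 0))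
      (fun a => Nat.rfind fun n => (fun m => decide (m = 0)) <$> f (Nat.pair a n)) where
  partrec := by
    refine Partrec.rfind (p := fun (q : List ℕ × ℕ) n =>
      (φ q.1 (Nat.pair q.2 n)).map fun m => decide (m = 0)) ?_
    refine Partrec.map (hf.partrec.comp (Computable.fst.comp Computable.fst)
      (Primrec₂.natPair.comp (Primrec.snd.comp Primrec.fst) Primrec.snd).to_comp) ?_
    exact ((Primrec.eq.comp Primrec.snd (Primrec.const 0)).decide).to_comp
  mono τ τ' h x y hy := by
    obtain ⟨hy0, hy⟩ := Nat.mem_rfind.1 hy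
    obtain ⟨a, ha, h0⟩ := (Part.mem_map_iff _).1 hy0
    refine Nat.mem_rfind.2 ⟨(Part.mem_map_iff _).2 ⟨a, hf.mono _ _ h _ _ ha, h0⟩, fun {m} hm => ?_⟩
    obtain ⟨b, hb, h1⟩ := (Part.mem_map_iff _).1 (hy hm)
    exact (Part.mem_map_iff _).2 ⟨b, hf.mono _ _ h _ _ hb, h1⟩
  sound x y n hy := by
    obtain ⟨hy0, hy⟩ := Nat.mem_rfind.1 hy
    obtain ⟨a, ha, h0⟩ := (Part.mem_map_iff _).1 hy0
    refine Nat.mem_rfind.2 ⟨(Part.mem_map_iff _).2 ⟨a, hf.sound _ _ _ ha, h0⟩, fun {m} hm => ?_⟩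
    obtain ⟨b, hb, h1⟩ := (Part.mem_map_iff _).1 (hy hm)
    exact (Part.mem_map_iff _).2 ⟨b, hf.sound _ _ _ hb, h1⟩
  complete x y hy := by
    obtain ⟨hy0, hy⟩ := Nat.mem_rfind.1 hy
    obtain ⟨a, ha, h0⟩ := (Part.mem_map_iff _).1 hy0
    -- Only finitely many failed values precede `y`, so one long enough prefix serves them all.
    have hall : ∀ m ∈ Finset.range y, ∀ᶠ n in atTop,
        false ∈ (φ (oraclePrefix A n) (Nat.pair x m)).map fun b => decide (b = 0) := by
      intro m hm
      obtain ⟨b, hb, h1⟩ := (Part.mem_map_iff _).1 (hy (Finset.mem_range.1 hm))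
      filter_upwards [hf.complete _ _ hb] with n hn
      exact (Part.mem_map_iff _).2 ⟨b, hn, h1⟩
    filter_upwards [hf.complete _ _ ha, (eventually_all_finset _).2 hall] with n h1 h2
    exact Nat.mem_rfind.2 ⟨(Part.mem_map_iff _).2 ⟨a, h1, h0⟩,
      fun {m} hm => h2 m (Finset.mem_range.2 hm)⟩

end IsFunctionalFor

/-- The use principle. -/
theorem Nat.RecursiveIn.exists_isFunctionalFor {A : ℕ → ℕ} {i : ℕ} {h : ℕ →. ℕ}
    (hh : Nat.RecursiveIn {fun z => Part.some (A (Nat.pair i z))} h) :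
    ∃ φ, IsFunctionalFor A i φ h := by
  induction hh with
  | zero => exact ⟨_, .of_partrec .zero⟩
  | succ => exact ⟨_, .of_partrec .succ⟩
  | left => exact ⟨_, .of_partrec .left⟩
  | right => exact ⟨_, .of_partrec .right⟩
  | oracle g hg => obtain rfl := Set.mem_singleton_iff.1 hg; exact ⟨_, .oracle⟩
  | pair _ _ hf hg => exact ⟨_, hf.choose_spec.pair hg.choose_spec⟩
  | comp _ _ hf hg => exact ⟨_, hf.choose_spec.comp hg.choose_spec⟩
  | prec _ _ hf hg => exact ⟨_, hf.choose_spec.prec hg.choose_spec⟩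
  | rfind _ hf => exact ⟨_, hf.choose_spec.rfind⟩

/-! ### The finite extension construction and its computable approximation -/

open Nat.Partrec (Code)

/-- `w` codes an extension `ρ` of `σ` and a running time after which the functional and the columns
coded by `e` are seen to disagree at the argument `σ.length`. -/
def disagreementTest (q : List ℕ × ℕ) (w : ℕ) : Bool :=
  let e := Denumerable.ofNat (Code × ℕ × ℕ) q.2
  let r := Denumerable.ofNat (List ℕ × ℕ) w
  let o := Code.evaln r.2 e.1 (Encodable.encode (q.1 ++ r.1, q.1.length))
  let v := (q.1 ++ r.1)[Nat.pair e.2.2 q.1.length]?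
  o.isSome && (v.isSome && !decide (o = v))

theorem primrec_disagreementTest : Primrec₂ disagreementTest := by
  have he : Primrec fun p : (List ℕ × ℕ) × ℕ => Denumerable.ofNat (Code × ℕ × ℕ) p.1.2 :=
    (Primrec.ofNat _).comp (Primrec.snd.comp Primrec.fst)
  have hr : Primrec fun p : (List ℕ × ℕ) × ℕ => Denumerable.ofNat (List ℕ × ℕ) p.2 :=
    (Primrec.ofNat _).comp Primrec.snd
  have hσ : Primrec fun p : (List ℕ × ℕ) × ℕ => p.1.1 := Primrec.fst.comp Primrec.fst
  have hτ := Primrec.list_append.comp hσ (Primrec.fst.comp hr)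
  have hl := Primrec.list_length.comp hσ
  have ho := Code.primrec_evaln.comp (((Primrec.snd.comp hr).pair (Primrec.fst.comp he)).pair
    (Primrec.encode.comp (hτ.pair hl)))
  have hv := Primrec.list_getElem?.comp hτ
    (Primrec₂.natPair.comp (Primrec.snd.comp (Primrec.snd.comp he)) hl)
  exact Primrec.and.comp (Primrec.option_isSome.comp ho) (Primrec.and.comp
    (Primrec.option_isSome.comp hv) (Primrec.not.comp (Primrec.eq.comp ho hv).decide))

theorem disagreementTest_eq_true {σ : List ℕ} {e w : ℕ} :
    disagreementTest (σ, e) w = true ↔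
      ∃ y v, y ∈ Code.evaln (Denumerable.ofNat (List ℕ × ℕ) w).2
          (Denumerable.ofNat (Code × ℕ × ℕ) e).1
          (Encodable.encode (σ ++ (Denumerable.ofNat (List ℕ × ℕ) w).1, σ.length)) ∧
        (σ ++ (Denumerable.ofNat (List ℕ × ℕ) w).1)[
          Nat.pair (Denumerable.ofNat (Code × ℕ × ℕ) e).2.2 σ.length]? = some v ∧ y ≠ v := by
  simp only [disagreementTest, Bool.and_eq_true, Option.isSome_iff_exists, Bool.not_eq_true',
    decide_eq_false_iff_not, Option.mem_def]
  constructor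
  · rintro ⟨⟨y, hy⟩, ⟨v, hv⟩, h⟩
    refine ⟨y, v, hy, hv, ?_⟩
    rintro rfl
    exact h (hy.trans hv.symm)
  · rintro ⟨y, v, hy, hv, h⟩
    refine ⟨⟨y, hy⟩, ⟨v, hv⟩, ?_⟩
    rw [hy, hv]
    simpa using h

/-- The least candidate below `s` that passes the test, or `s` if there is none. -/
def searchBelow (s : ℕ) (q : List ℕ × ℕ) : ℕ := (List.range s).findIdx (disagreementTest q)

theorem searchBelow_lt {s : ℕ} {q : List ℕ × ℕ} (h : searchBelow s q < s) :
    disagreementTest q (searchBelow s q) = true := by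
  have := List.findIdx_getElem (xs := List.range s) (p := disagreementTest q)
    (w := by simpa [searchBelow] using h)
  simpa [searchBelow] using this

theorem searchBelow_eq_find {s : ℕ} {q : List ℕ × ℕ} (h : ∃ w, disagreementTest q w = true)
    (hs : Nat.find h < s) : searchBelow s q = Nat.find h := by
  unfold searchBelow
  rw [List.findIdx_eq (by simpa using hs)]
  refine ⟨by simpa using Nat.find_spec h, fun j hj => ?_⟩
  simpa using Nat.find_min h hj

theorem searchBelow_eq_self {s : ℕ} {q : List ℕ × ℕ} (h : ¬∃ w, disagreementTest q w = true) :
    searchBelow s q = s := by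
  have h1 : searchBelow s q ≤ s := by
    simpa [searchBelow] using List.findIdx_le_length (xs := List.range s) (p := disagreementTest q)
  by_contra h2
  exact h ⟨_, searchBelow_lt (lt_of_le_of_ne h1 h2)⟩

/-- One step of the finite extension construction, with searches bounded by `s`. -/
def extensionStep (s : ℕ) (q : List ℕ × ℕ) : List ℕ :=
  -- The final `[0]` forces growth at every step, even after a failed search, so the limit is total.
  q.1 ++ (if searchBelow s q < s then
    (Denumerable.ofNat (List ℕ × ℕ) (searchBelow s q)).1 else []) ++ [0]

theorem primrec_extensionStep : Primrec₂ extensionStep := by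
  have hs : Primrec fun p : ℕ × List ℕ × ℕ => searchBelow p.1 p.2 :=
    Primrec.list_findIdx (Primrec.list_range.comp Primrec.fst)
      (primrec_disagreementTest.comp (Primrec.snd.comp Primrec.fst) Primrec.snd)
  refine Primrec.list_append.comp (Primrec.list_append.comp (Primrec.fst.comp Primrec.snd) ?_)
    (Primrec.const [0])
  exact Primrec.ite (Primrec.nat_lt.comp hs Primrec.fst)
    (Primrec.fst.comp ((Primrec.ofNat _).comp hs)) (Primrec.const [])

/-- The `e`-th finite extension, as guessed with searches bounded by `s`. -/
def extensionApprox (s e : ℕ) : List ℕ :=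
  Nat.rec [] (fun e σ => extensionStep s (σ, e)) e

theorem primrec_extensionApprox : Primrec₂ extensionApprox := by
  refine Primrec.nat_rec' (f := fun p : ℕ × ℕ => p.2) (g := fun _ => ([] : List ℕ))
    (h := fun (p : ℕ × ℕ) (r : ℕ × List ℕ) => extensionStep p.1 (r.2, r.1))
    Primrec.snd (Primrec.const _) ?_
  exact primrec_extensionStep.comp (Primrec.fst.comp Primrec.fst)
    ((Primrec.snd.comp Primrec.snd).pair (Primrec.fst.comp Primrec.snd))

/-- Either the least witness is found by every large bound, or every search fails in the same way.
-/
theorem extensionStep_eventually (q : List ℕ × ℕ) :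
    ∃ τ, ∀ᶠ s in atTop, extensionStep s q = τ := by
  by_cases h : ∃ w, disagreementTest q w = true
  · refine ⟨q.1 ++ (Denumerable.ofNat (List ℕ × ℕ) (Nat.find h)).1 ++ [0], ?_⟩
    filter_upwards [eventually_gt_atTop (Nat.find h)] with s hs
    simp only [extensionStep, searchBelow_eq_find h hs, if_pos hs]
  · refine ⟨q.1 ++ [] ++ [0], Eventually.of_forall fun s => ?_⟩
    simp only [extensionStep, searchBelow_eq_self h, lt_irrefl, if_false]

theorem extensionApprox_eventually (e : ℕ) :
    ∃ τ, ∀ᶠ s in atTop, extensionApprox s e = τ := by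
  induction e with
  | zero => exact ⟨[], Eventually.of_forall fun _ => rfl⟩
  | succ e ih =>
    obtain ⟨σ, hσ⟩ := ih
    obtain ⟨τ, hτ⟩ := extensionStep_eventually (σ, e)
    refine ⟨τ, ?_⟩
    filter_upwards [hσ, hτ] with s h1 h2
    exact (congrArg (fun σ => extensionStep s (σ, e)) h1).trans h2

/-- The `e`-th finite extension. -/
noncomputable def extensionLimit (e : ℕ) : List ℕ := (extensionApprox_eventually e).choose

theorem extensionLimit_spec (e : ℕ) :
    ∀ᶠ s in atTop, extensionApprox s e = extensionLimit e :=
  (extensionApprox_eventually e).choose_spec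

theorem extensionLimit_succ (e : ℕ) :
    ∀ᶠ s in atTop, extensionLimit (e + 1) = extensionStep s (extensionLimit e, e) := by
  filter_upwards [extensionLimit_spec e, extensionLimit_spec (e + 1)] with s h1 h2
  rw [← h1, ← h2]
  rfl

theorem extensionLimit_prefix_succ (e : ℕ) :
    ∃ ρ, extensionLimit (e + 1) = extensionLimit e ++ ρ ++ [0] := by
  obtain ⟨s, hs⟩ := (extensionLimit_succ e).exists
  exact ⟨_, hs⟩

theorem extensionLimit_prefix {d e : ℕ} (h : d ≤ e) : extensionLimit d <+: extensionLimit e := by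
  induction h with
  | refl => exact List.prefix_rfl
  | step _ ih =>
    obtain ⟨ρ, hρ⟩ := extensionLimit_prefix_succ _
    exact ih.trans (by rw [hρ, List.append_assoc]; exact List.prefix_append _ _)

theorem le_length_extensionLimit (e : ℕ) : e ≤ (extensionLimit e).length := by
  induction e with
  | zero => simp
  | succ e ih =>
    obtain ⟨ρ, hρ⟩ := extensionLimit_prefix_succ e
    rw [hρ]
    simp only [List.length_append, List.length_singleton]
    omega

/-- The function approximated by the construction. -/
noncomputable def genericArray (m : ℕ) : ℕ := (extensionLimit (m + 1)).getD m 0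

theorem getElem?_extensionLimit {e m : ℕ} (h : m < (extensionLimit e).length) :
    (extensionLimit e)[m]? = some (genericArray m) := by
  -- Hence the default 0 in `genericArray` is never used.
  have hm : m < (extensionLimit (m + 1)).length := le_length_extensionLimit (m + 1)
  have key : (extensionLimit e)[m]? = (extensionLimit (m + 1))[m]? := by
    rcases le_total e (m + 1) with h' | h'
    · exact (List.prefix_iff_getElem?.1 (extensionLimit_prefix h') m h).symm ▸
        List.getElem?_eq_getElem h
    · rw [List.prefix_iff_getElem?.1 (extensionLimit_prefix h') m hm, List.getElem?_eq_getElem hm]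
  rw [key, genericArray, List.getD_eq_getElem?_getD, List.getElem?_eq_getElem hm]
  rfl

/-- The computable approximation to the array. -/
def arrayApprox (m s : ℕ) : ℕ := (extensionApprox s (m + 1)).getD m 0

theorem primrec_arrayApprox : Primrec₂ arrayApprox :=
  (Primrec.list_getD 0).comp (primrec_extensionApprox.comp Primrec.snd
    (Primrec.succ.comp Primrec.fst)) Primrec.fst

theorem arrayApprox_eventually (m : ℕ) :
    ∀ᶠ s in atTop, arrayApprox m s = genericArray m := by
  filter_upwards [extensionLimit_spec (m + 1)] with s hs
  rw [arrayApprox, hs, genericArray]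

/-! ### Incomparability of the columns -/

theorem Nat.Partrec.Code.exists_eval_encode {φ : List ℕ → ℕ →. ℕ} (hφ : Partrec₂ φ) :
    ∃ c : Code, ∀ τ x, c.eval (Encodable.encode (τ, x)) = φ τ x := by
  obtain ⟨c, hc⟩ := Code.exists_code.1 (show Nat.Partrec _ from hφ)
  refine ⟨c, fun τ x => ?_⟩
  rw [hc]
  simp only [Encodable.encodek, Part.coe_some, Part.bind_some]
  exact Part.map_id' (fun _ => rfl) _

/-- Distinct columns of the array are not computable from each other. -/
theorem genericArray_column_not_reducible {i j : ℕ} (hij : i ≠ j) :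
    ¬ Nat.RecursiveIn {fun z => Part.some (genericArray (Nat.pair i z))}
      (fun z => Part.some (genericArray (Nat.pair j z))) := by
  intro hrec
  obtain ⟨φ, hφ⟩ := hrec.exists_isFunctionalFor
  obtain ⟨c, hc⟩ := Code.exists_eval_encode hφ.partrec
  set e := Encodable.encode (c, i, j) with he
  have hofe : Denumerable.ofNat (Code × ℕ × ℕ) e = (c, i, j) := Denumerable.ofNat_encode _
  set σ := extensionLimit e with hσ
  by_cases hw : ∃ w, disagreementTest (σ, e) w = true
  · obtain ⟨s, hs, hlt⟩ := ((extensionLimit_succ e).and (eventually_gt_atTop (Nat.find hw))).exists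
    have hfind := searchBelow_eq_find hw hlt
    have htest := Nat.find_spec hw
    rw [extensionStep, ← hσ, hfind, if_pos hlt] at hs
    set r := Denumerable.ofNat (List ℕ × ℕ) (Nat.find hw) with hr
    obtain ⟨y, v, hy, hv, hne⟩ := disagreementTest_eq_true.1 htest
    rw [hofe, ← hr] at hy hv
    -- The witness was adopted at step `e`, so it is a true prefix of the array and its disagreement
    -- contradicts soundness.
    have hτ : σ ++ r.1 = oraclePrefix genericArray (σ ++ r.1).length := by
      apply List.ext_getElem?
      intro m
      rw [oraclePrefix_getElem?]
      split_ifs with h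
      · rw [← getElem?_extensionLimit (e := e + 1) (by rw [hs]; simp at h ⊢; omega), hs,
          List.getElem?_append_left h]
      · exact List.getElem?_eq_none (not_lt.1 h)
    have hy' := Code.evaln_sound hy
    rw [hc, hτ] at hy'
    have h1 := hφ.sound _ _ _ hy'
    rw [Part.mem_some_iff] at h1
    rw [hτ, oraclePrefix_getElem?] at hv
    split_ifs at hv
    exact hne (h1.trans (Option.some.inj hv))
  · refine hw ?_
    -- A witness can always be made. Entry `p` lies beyond `σ` and outside column `i`, so increasing
    -- it in a long prefix keeps both `σ` and the computation, while the output becomes wrong.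
    set p := Nat.pair j σ.length with hp
    have hpσ : σ.length ≤ p := Nat.right_le_pair _ _
    obtain ⟨n, hn, hpn⟩ := ((hφ.complete σ.length (genericArray p) (Part.mem_some _)).and
      (eventually_gt_atTop p)).exists
    set τ := (oraclePrefix genericArray n).set p (genericArray p + 1) with hτ
    have hget : ∀ m, m ≠ p → τ[m]? = (oraclePrefix genericArray n)[m]? := fun m hm => by
      rw [hτ, List.getElem?_set_ne (Ne.symm hm)]
    have hn' := hφ.mono _ τ (fun z v hz => by
      rw [hget _ fun h => hij (Nat.pair_eq_pair.1 h).1, hz]) _ _ hn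
    rw [← hc] at hn'
    obtain ⟨k, hk⟩ := Code.evaln_complete.1 hn'
    have hsplit : σ ++ τ.drop σ.length = τ := by
      conv_rhs => rw [← List.take_append_drop σ.length τ]
      congr 1
      apply List.ext_getElem?
      intro m
      rw [List.getElem?_take]
      split_ifs with h
      · rw [hget _ (by omega), oraclePrefix_getElem?, if_pos (by omega)]
        exact getElem?_extensionLimit h
      · exact List.getElem?_eq_none (not_lt.1 h)
    refine ⟨Encodable.encode (τ.drop σ.length, k), disagreementTest_eq_true.2
      ⟨genericArray p, genericArray p + 1, ?_⟩⟩
    rw [Denumerable.ofNat_encode, hofe, hsplit]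
    refine ⟨hk, ?_, by omega⟩
    rw [← hp, hτ, List.getElem?_set_self]
    simpa [oraclePrefix] using hpn

/-! ### Column paths and their degrees -/

/-- Stage `t` is at least `s` and its guess at entry `m` of the array is `v`. -/
def IsCorrectStage (m s v t : ℕ) : Prop := s ≤ t ∧ arrayApprox m t = v

instance (m s v t : ℕ) : Decidable (IsCorrectStage m s v t) :=
  inferInstanceAs (Decidable (_ ∧ _))

theorem primrecPred_isCorrectStage {α : Type*} [Primcodable α] {m s v t : α → ℕ}
    (hm : Primrec m) (hs : Primrec s) (hv : Primrec v) (ht : Primrec t) :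
    PrimrecPred fun x => IsCorrectStage (m x) (s x) (v x) (t x) :=
  (Primrec.nat_le.comp hs ht).and (Primrec.eq.comp (primrec_arrayApprox.comp hm ht) hv)

theorem exists_isCorrectStage (m s : ℕ) : ∃ t, IsCorrectStage m s (genericArray m) t :=
  ((eventually_ge_atTop s).and (arrayApprox_eventually m)).exists

/-- A function of the same degree as the `n`-th column of the array: at `⟨x, s⟩` it returns `n`
and the least stage from `s` on whose guess at the `x`-th entry of the column is correct. -/
noncomputable def columnPath (n p : ℕ) : ℕ :=
  Nat.pair n (Nat.find (exists_isCorrectStage (Nat.pair n p.unpair.1) p.unpair.2))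

theorem arrayApprox_columnPath (n x : ℕ) :
    arrayApprox (Nat.pair n x) (columnPath n (Nat.pair x 0)).unpair.2 =
      genericArray (Nat.pair n x) := by
  have := (Nat.find_spec
    (exists_isCorrectStage (Nat.pair n (Nat.pair x 0).unpair.1) (Nat.pair x 0).unpair.2)).2
  simp only [Nat.unpair_pair] at this
  simp [columnPath, this]

/-- The oracle supplies the true entry; an unbounded search then finds the first stage guessing it.
-/
theorem columnPath_reducible (n : ℕ) :
    Nat.RecursiveIn {fun z => Part.some (genericArray (Nat.pair n z))}
      (fun p => Part.some (columnPath n p)) := by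
  set O : Set (ℕ →. ℕ) := {fun z => Part.some (genericArray (Nat.pair n z))}
  let d : ℕ → ℕ := fun q => if IsCorrectStage (Nat.pair n q.unpair.1.unpair.1.unpair.1)
    q.unpair.1.unpair.1.unpair.2 q.unpair.1.unpair.2 q.unpair.2 then 0 else 1
  have h1 : Primrec fun q : ℕ => q.unpair.1 := Primrec.fst.comp Primrec.unpair
  have h2 : Primrec fun q : ℕ => q.unpair.2 := Primrec.snd.comp Primrec.unpair
  have hd : Primrec d := Primrec.ite (primrecPred_isCorrectStage
    (Primrec₂.natPair.comp (Primrec.const n) (h1.comp (h1.comp h1)))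
    (h2.comp (h1.comp h1)) (h2.comp h1) h2) (Primrec.const 0) (Primrec.const 1)
  have hd' : Nat.RecursiveIn O (fun q => Part.some (d q)) :=
    (Partrec.nat_iff.1 hd.to_comp.partrec).recursiveIn
  have hn : Nat.RecursiveIn O (fun t => Part.some (Nat.pair n t)) :=
    (Partrec.nat_iff.1
      (Primrec₂.natPair.comp (Primrec.const n) Primrec.id).to_comp.partrec).recursiveIn
  have hid : Nat.RecursiveIn O (fun t => Part.some t) :=
    (Partrec.nat_iff.1 Computable.id.partrec).recursiveIn
  have hO := Nat.RecursiveIn.oracle (O := O) _ rfl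
  refine Nat.RecursiveIn.of_eq_tot
    (Nat.RecursiveIn.comp hn (Nat.RecursiveIn.comp (Nat.RecursiveIn.rfind hd')
      (Nat.RecursiveIn.pair hid (Nat.RecursiveIn.comp hO Nat.RecursiveIn.left)))) fun p => ?_
  have hfind := exists_isCorrectStage (Nat.pair n p.unpair.1) p.unpair.2
  refine Part.mem_bind_iff.2 ⟨Nat.find hfind, Part.mem_bind_iff.2
    ⟨Nat.pair p (genericArray (Nat.pair n p.unpair.1)), ?_, Nat.mem_rfind.2 ⟨?_, fun {m} hm => ?_⟩⟩,
    Part.mem_some _⟩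
  · simp [Seq.seq]
  · have := Nat.find_spec hfind
    simpa [d] using this
  · have := Nat.find_min hfind hm
    simpa [d] using this

theorem column_reducible (n : ℕ) :
    Nat.RecursiveIn {fun p => Part.some (columnPath n p)}
      (fun z => Part.some (genericArray (Nat.pair n z))) := by
  set O : Set (ℕ →. ℕ) := {fun p => Part.some (columnPath n p)}
  have h2 : Primrec fun q : ℕ => q.unpair.2 := Primrec.snd.comp Primrec.unpair
  have hg : Nat.RecursiveIn O (fun x => Part.some (Nat.pair x 0)) :=
    (Partrec.nat_iff.1
      (Primrec₂.natPair.comp Primrec.id (Primrec.const 0)).to_comp.partrec).recursiveIn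
  have hid : Nat.RecursiveIn O (fun t => Part.some t) :=
    (Partrec.nat_iff.1 Computable.id.partrec).recursiveIn
  have ha : Nat.RecursiveIn O
      (fun q => Part.some (arrayApprox (Nat.pair n q.unpair.1) q.unpair.2.unpair.2)) :=
    (Partrec.nat_iff.1 (primrec_arrayApprox.comp (Primrec₂.natPair.comp (Primrec.const n)
      (Primrec.fst.comp Primrec.unpair)) (h2.comp h2)).to_comp.partrec).recursiveIn
  have hO := Nat.RecursiveIn.oracle (O := O) _ rfl
  refine Nat.RecursiveIn.of_eq_tot (Nat.RecursiveIn.comp ha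
    (Nat.RecursiveIn.pair hid (Nat.RecursiveIn.comp hO hg))) fun x => ?_
  refine Part.mem_bind_iff.2 ⟨Nat.pair x (columnPath n (Nat.pair x 0)), ?_, ?_⟩
  · simp [Seq.seq]
  · simp [arrayApprox_columnPath]

/-! ### The effectively closed set of column paths -/

theorem PrimrecRel.forall_lt_comp {α : Type*} [Primcodable α] {R : ℕ → α → Prop}
    (hR : PrimrecRel R) {f : α → ℕ} (hf : Primrec f) : PrimrecPred fun x => ∀ u < f x, R u x := by
  have h := PrimrecRel.comp hR.forall_mem_list (Primrec.list_range.comp hf) Primrec.id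
  exact h.of_eq fun x => by simp

/-- The local condition at `p` describing the set of column paths, in terms of the values `a` at
`0`, `b` at `⟨x, 0⟩` and `c` at `p = ⟨x, s⟩`. -/
def PathCondition (a b c p : ℕ) : Prop :=
  c.unpair.1 = a.unpair.1 ∧
    IsCorrectStage (Nat.pair c.unpair.1 p.unpair.1) p.unpair.2
      (arrayApprox (Nat.pair c.unpair.1 p.unpair.1) b.unpair.2) c.unpair.2 ∧
    ∀ u < c.unpair.2, ¬ IsCorrectStage (Nat.pair c.unpair.1 p.unpair.1) p.unpair.2
      (arrayApprox (Nat.pair c.unpair.1 p.unpair.1) b.unpair.2) u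

theorem primrecPred_pathCondition {α : Type*} [Primcodable α] {a b c p : α → ℕ}
    (ha : Primrec a) (hb : Primrec b) (hc : Primrec c) (hp : Primrec p) :
    PrimrecPred fun x => PathCondition (a x) (b x) (c x) (p x) := by
  have h1 : Primrec fun q : ℕ => q.unpair.1 := Primrec.fst.comp Primrec.unpair
  have h2 : Primrec fun q : ℕ => q.unpair.2 := Primrec.snd.comp Primrec.unpair
  have hm := Primrec₂.natPair.comp (h1.comp hc) (h1.comp hp)
  have hv := primrec_arrayApprox.comp hm (h2.comp hb)
  have hR : PrimrecRel fun (u : ℕ) (x : α) =>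
      ¬ IsCorrectStage (Nat.pair (c x).unpair.1 (p x).unpair.1) (p x).unpair.2
        (arrayApprox (Nat.pair (c x).unpair.1 (p x).unpair.1) (b x).unpair.2) u :=
    PrimrecPred.not (primrecPred_isCorrectStage (hm.comp Primrec.snd)
      ((h2.comp hp).comp Primrec.snd) (hv.comp Primrec.snd) Primrec.fst)
  have hmin := hR.forall_lt_comp (h2.comp hc)
  exact (Primrec.eq.comp (h1.comp hc) (h1.comp ha)).and
    ((primrecPred_isCorrectStage hm (h2.comp hp) hv (h2.comp hc)).and hmin)

/-- The condition at `p` on a point of Baire space. -/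
def IsPathAt (f : ℕ → ℕ) (p : ℕ) : Prop :=
  PathCondition (f 0) (f (Nat.pair p.unpair.1 0)) (f p) p

theorem pair_zero_le (p : ℕ) : Nat.pair p.unpair.1 0 ≤ p := by
  conv_rhs => rw [← Nat.pair_unpair p]
  rcases Nat.eq_zero_or_pos p.unpair.2 with h | h
  · rw [h]
  · exact (Nat.pair_lt_pair_right _ h).le

theorem isPathAt_congr {f g : ℕ → ℕ} {p : ℕ} (h : ∀ m ≤ p, f m = g m) :
    IsPathAt f p ↔ IsPathAt g p := by
  rw [IsPathAt, IsPathAt, h 0 (Nat.zero_le _), h _ (pair_zero_le p), h p le_rfl]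

theorem isPathAt_columnPath (n p : ℕ) : IsPathAt (columnPath n) p := by
  have hn : ∀ q, (columnPath n q).unpair.1 = n := fun q => by simp [columnPath]
  have h2 : (columnPath n p).unpair.2 =
      Nat.find (exists_isCorrectStage (Nat.pair n p.unpair.1) p.unpair.2) := by simp [columnPath]
  rw [IsPathAt, PathCondition, hn, hn, arrayApprox_columnPath, h2]
  exact ⟨rfl, Nat.find_spec _, fun u hu => Nat.find_min _ hu⟩

/-- The value guessed at stage `(f ⟨x, 0⟩).unpair.2` is guessed again past every `s`, so it is the
limit; minimality of the stages then determines `f`. -/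
theorem eq_columnPath {f : ℕ → ℕ} (h : ∀ p, IsPathAt f p) : f = columnPath (f 0).unpair.1 := by
  set n := (f 0).unpair.1 with hn
  have h1 : ∀ p, (f p).unpair.1 = n := fun p => (h p).1
  have hv : ∀ x, arrayApprox (Nat.pair n x) (f (Nat.pair x 0)).unpair.2 =
      genericArray (Nat.pair n x) := by
    intro x
    obtain ⟨s, hs⟩ := eventually_atTop.1 (arrayApprox_eventually (Nat.pair n x))
    have := (h (Nat.pair x s)).2.1
    rw [h1, Nat.unpair_pair] at this
    rw [← this.2]
    exact hs _ this.1
  funext p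
  obtain ⟨-, h2, h3⟩ := h p
  rw [h1, hv] at h2 h3
  rw [columnPath, (Nat.find_eq_iff _).2 ⟨h2, fun u hu => h3 u hu⟩, ← h1 p, Nat.pair_unpair]

/-- The tree of finite sequences satisfying the path condition. -/
def columnTree : Descriptive.tree ℕ :=
  -- The condition at `p` reads only positions up to `p`, so the default 0 plays no role.
  ⟨{σ | ∀ p < σ.length, IsPathAt (fun m => σ.getD m 0) p}, by
    intro σ a hσ p hp
    refine (isPathAt_congr fun m hm => ?_).1 (hσ p (by simp; omega))
    simp [List.getElem?_append_left (lt_of_le_of_lt hm hp)]⟩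

theorem computablePred_columnTree : ComputablePred fun σ : List ℕ => σ ∈ columnTree := by
  have hget := Primrec.list_getD (0 : ℕ)
  have hR : PrimrecRel fun (p : ℕ) (σ : List ℕ) => IsPathAt (fun m => σ.getD m 0) p :=
    primrecPred_pathCondition (hget.comp Primrec.snd (Primrec.const 0))
      (hget.comp Primrec.snd (Primrec₂.natPair.comp
        (Primrec.fst.comp (Primrec.unpair.comp Primrec.fst)) (Primrec.const 0)))
      (hget.comp Primrec.snd Primrec.fst) Primrec.fst
  have hall := hR.forall_lt_comp Primrec.list_length
  exact PrimrecPred.computablePred hall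

theorem treePaths_columnTree : treePaths columnTree = {f | ∀ p, IsPathAt f p} := by
  ext f
  have hget : ∀ n p, p < n → (IsPathAt (fun m => (initialSegment f n).getD m 0) p ↔
      IsPathAt f p) := fun n p hp => isPathAt_congr fun m hm => by
    simp [initialSegment, lt_of_le_of_lt hm hp]
  constructor
  · intro h p
    exact (hget (p + 1) p p.lt_succ_self).1 (h (p + 1) p (by simp [initialSegment]))
  · intro h n p hp
    exact (hget n p (by simpa [initialSegment] using hp)).2 (h p)

theorem isClosed_setOf_isPathAt : IsClosed {f : ℕ → ℕ | ∀ p, IsPathAt f p} := by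
  rw [Set.ofPred_forall]
  refine isClosed_iInter fun p => ?_
  have hc : Continuous fun f : ℕ → ℕ => (f 0, f (Nat.pair p.unpair.1 0), f p) := by fun_prop
  exact (isClosed_discrete {q : ℕ × ℕ × ℕ | PathCondition q.1 q.2.1 q.2.2 p}).preimage hc

theorem columnPath_turingReducible_iff {m n : ℕ} :
    TuringReducible (columnPath m : ℕ →. ℕ) (columnPath n : ℕ →. ℕ) ↔ m = n := by
  refine ⟨fun h => ?_, fun h => h ▸ TuringReducible.refl _⟩
  by_contra hne
  refine genericArray_column_not_reducible (Ne.symm hne) ?_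
  -- Reductions are chained: column `m`, `columnPath m`, `columnPath n`, column `n`.
  refine (column_reducible m).subst fun g hg => ?_
  obtain rfl := Set.mem_singleton_iff.1 hg
  refine (RecursiveIn.iff_nat.1 h).subst fun g hg => ?_
  obtain rfl := Set.mem_singleton_iff.1 hg
  exact columnPath_reducible n

theorem mainTheorem2 :
    ∃ Q : Set (ℕ → ℕ), Q.Nonempty ∧ IsClosed Q ∧ IsPiZeroOne Q ∧ ¬ IsCompact Q ∧
      ∀ f ∈ Q, ∀ g ∈ Q, f ≠ g → TuringIncomparable f g := by
  refine ⟨{f | ∀ p, IsPathAt f p}, ⟨columnPath 0, isPathAt_columnPath 0⟩,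
    isClosed_setOf_isPathAt, ⟨columnTree, computablePred_columnTree, treePaths_columnTree.symm⟩,
    fun hcpt => ?_, fun f hf g hg hfg => ?_⟩
  -- Compactness would bound coordinate 0, but `columnPath n 0` is at least `n`.
  · obtain ⟨b, hb⟩ := (hcpt.image (continuous_apply 0)).bddAbove
    have h1 := hb ⟨columnPath (b + 1), isPathAt_columnPath (b + 1), rfl⟩
    have h2 : b + 1 ≤ columnPath (b + 1) 0 := Nat.left_le_pair _ _
    exact absurd (h2.trans h1) (by omega)
  · rw [eq_columnPath hf, eq_columnPath hg] at hfg ⊢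
    have hne := fun h => hfg (congrArg columnPath h)
    exact ⟨fun h => hne (columnPath_turingReducible_iff.1 h),
      fun h => hne (columnPath_turingReducible_iff.1 h).symm⟩
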